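/- For $\alpha\in\mathbb R$ and $k\in\mathbb N_0$ let $\binom{\alpha}{k}=\frac{\alpha(\alpha-1)\cdots(\alpha-k+1)}{k!}$ (with $\binom{\alpha}{0}=1$). Define the indices of coincidence $$U_n(x)=\sum_{k=0}^{n}\Big(\binom nk x^k(1+x)^{-n}\Big)^2\quad (n\in\mathbb N_0,\ x\ge 0),$$ $$G_n(x)=\sum_{k=0}^{\infty}\Big(\binom{n+k-1}{k} x^k(1+x)^{-n-k}\Big)^2\quad (n\in[0,\infty),\ x\ge 0),$$ $$J_n(x)=\sum_{k=0}^{\infty}\Big(\binom{n+k}{k} x^k(1-x)^{n+1}\Big)^2\quad (n\in[0,\infty),\ 0\le x<1)$$ of the Bleimann–Butzer–Hahn, negative binomial (Baskakov) and Meyer-König–Zeller distributions. The series defining $G_n(x)$ and $J_n(x)$ converge, and the following inequalities hold. (a) For every integer $n\ge 1$ and every $x\ge 0$, $$2U_n(x)\le U_{n-1}(x)+U_{n+1}(x),$$ $$U_{n+1}(x)\le\frac{1+4nx+x^2}{1+(4n+4)x+x^2}\,U_{n-1}(x),\qquad U_n(x)\le\frac{1+(4n+2)x+x^2}{1+(4n+4)x+x^2}\,U_{n-1}(x).$$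 (b) For every real $n\ge 1$ (in particular every integer $n\ge1$) and every $x\ge 0$, $$2G_n(x)\le G_{n-1}(x)+G_{n+1}(x),$$ $$G_{n+1}(x)\le\frac{1+(4n-2)x(1+x)}{1+(4n+2)x(1+x)}\,G_{n-1}(x),\qquad G_n(x)\le\frac{1+4nx(x+1)}{1+(4n+2)x(x+1)}\,G_{n-1}(x).$$ (c) For every real $n\ge 1$ (in particular every integer $n\ge1$) and every $x\in[0,1)$, $$2J_n(x)\le J_{n-1}(x)+J_{n+1}(x),$$ $$J_{n+1}(x)\le\frac{1+4nx+x^2}{1+(4n+4)x+x^2}\,J_{n-1}(x),\qquad J_n(x)\le\frac{1+(4n+2)x+x^2}{1+(4n+4)x+x^2}\,J_{n-1}(x).$$ -/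

import Mathlib

noncomputable section

/-- The index of coincidence of the Bleimann-Butzer-Hahn distribution
`(C(n,k) x^k (1+x)^(-n))_{k=0,...,n}`, for `x ≥ 0`. -/
def indexU (n : ℕ) (x : ℝ) : ℝ :=
  ∑ k ∈ Finset.range (n + 1), ((n.choose k : ℝ) * x ^ k / (1 + x) ^ n) ^ 2

/-- The weights `C(n+k-1,k) x^k (1+x)^(-n-k)` of the negative binomial distribution, with a real
parameter `n` and `x ≥ 0`; `Ring.choose` is the generalized binomial coefficient
`α (α-1) ⋯ (α-k+1) / k!`. -/
def weightG (n x : ℝ) (k : ℕ) : ℝ :=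
  Ring.choose (n + (k : ℝ) - 1) k * x ^ k * (1 + x) ^ (-n - (k : ℝ))

/-- The index of coincidence of the negative binomial distribution. -/
def indexG (n x : ℝ) : ℝ := ∑' k : ℕ, (weightG n x k) ^ 2

/-- The weights `C(n+k,k) x^k (1-x)^(n+1)` connected with the Meyer-König and Zeller operators,
with a real parameter `n` and `0 ≤ x < 1`. -/
def weightJ (n x : ℝ) (k : ℕ) : ℝ :=
  Ring.choose (n + (k : ℝ)) k * x ^ k * (1 - x) ^ (n + 1)

/-- The index of coincidence of the distribution connected with the Meyer-König and Zeller
operators. -/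
def indexJ (n x : ℝ) : ℝ := ∑' k : ℕ, (weightJ n x k) ^ 2

end

/-!
By Parseval's identity on the unit circle, an index of coincidence `∑ w_k ^ 2` is the mean of
`‖∑ w_k z ^ k‖ ^ 2` over `‖z‖ = 1`. For the three families the generating function is a power of
`(1 + x z) / (1 + x)`, so all of them are values of a single function
`I(x, s) = mean of (‖1 + x z‖ ^ 2 / (1 + x) ^ 2) ^ s`:
`U_n(x) = I(x, n)`, `J_n(x) = I(-x, -(n + 1))` and `G_n(x) = J_{n-1}(x / (1 + x))`.
The kernel has the form `a + b cos θ`, so `I(x, ·)` is a Laplace integral of a Legendre function.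
It is convex in `s` because the kernel is nonnegative, and satisfies Legendre's three-term
recurrence; eliminating one of three consecutive values between the two gives the ratio bounds.
-/

open MeasureTheory Real

section Parseval

theorem hasSum_norm_sq_of_orthonormal {ι 𝕜 E : Type*} [RCLike 𝕜] [NormedAddCommGroup E]
    [InnerProductSpace 𝕜 E] {v : ι → E} (hv : Orthonormal 𝕜 v) {c : ι → 𝕜} {f : E}
    (hf : HasSum (fun i => c i • v i) f) : HasSum (fun i => ‖c i‖ ^ 2) (‖f‖ ^ 2) := by
  have hnorm (s : Finset ι) : ‖∑ i ∈ s, c i • v i‖ ^ 2 = ∑ i ∈ s, ‖c i‖ ^ 2 := by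
    simpa using hv.orthogonalFamily.norm_sum c s
  simpa only [HasSum, hnorm] using hf.norm.pow 2

theorem norm_toLp_sq_eq_integral {α 𝕜 : Type*} [RCLike 𝕜] [TopologicalSpace α] [CompactSpace α]
    [MeasurableSpace α] [BorelSpace α] {μ : Measure α} [IsFiniteMeasure μ] (f : C(α, 𝕜)) :
    ‖ContinuousMap.toLp 2 μ 𝕜 f‖ ^ 2 = ∫ t, ‖f t‖ ^ 2 ∂μ := by
  have h := ContinuousMap.inner_toLp (𝕜 := 𝕜) μ f f
  simp only [inner_self_eq_norm_sq_to_K, RCLike.mul_conj] at h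
  exact_mod_cast h

local instance : Fact (0 < 2 * π) := ⟨two_pi_pos⟩

theorem integral_haarAddCircle_eq_circleAverage (g : ℂ → ℝ) :
    ∫ t : AddCircle (2 * π), g (AddCircle.toCircle t) ∂AddCircle.haarAddCircle =
      circleAverage g 0 1 := by
  rw [AddCircle.integral_haarAddCircle, circleAverage, ← AddCircle.intervalIntegral_preimage _ 0]
  simp [AddCircle.toCircle, circleMap]

theorem hasSum_norm_sq_circleAverage {c : ℕ → ℂ} {F : ℂ → ℂ}
    (hF : ∀ z, ‖z‖ = 1 → HasSum (fun k => c k * z ^ k) (F z)) :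
    HasSum (fun k => ‖c k‖ ^ 2) (circleAverage (fun z => ‖F z‖ ^ 2) 0 1) := by
  have hc : Summable c := by simpa using (hF 1 norm_one).summable
  obtain ⟨f, hf⟩ : Summable fun k : ℕ => c k • fourier (T := 2 * π) k :=
    .of_norm (by simpa only [norm_smul, fourier_norm (T := 2 * π), mul_one] using hc.norm)
  have hfF (t : AddCircle (2 * π)) : f t = F (AddCircle.toCircle t) := by
    refine ((ContinuousMap.evalCLM ℂ t).hasSum hf).unique ?_
    simpa [AddCircle.toCircle_nsmul] using hF (AddCircle.toCircle t) (Circle.norm_coe _)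
  have hLp := (ContinuousMap.toLp (E := ℂ) 2 AddCircle.haarAddCircle ℂ).hasSum hf
  have hv := (orthonormal_fourier (T := 2 * π)).comp ((↑) : ℕ → ℤ) Nat.cast_injective
  have h := hasSum_norm_sq_of_orthonormal hv (by simpa [fourierLp] using hLp)
  simpa only [norm_toLp_sq_eq_integral, hfF,
    integral_haarAddCircle_eq_circleAverage fun z => ‖F z‖ ^ 2] using h

end Parseval

section LaplaceIntegral

/-- Laplace's integral, the mean of `(a + b cos θ) ^ s` over a period. Up to the factor
`(a ^ 2 - b ^ 2) ^ (s / 2)` it is the Legendre function of degree `s` at `a / √(a ^ 2 - b ^ 2)`. -/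
noncomputable def laplaceIntegral (a b s : ℝ) : ℝ :=
  (2 * π)⁻¹ * ∫ θ in 0..2 * π, (a + b * cos θ) ^ s

theorem laplaceIntegral_eq_circleAverage (a b s : ℝ) :
    laplaceIntegral a b s = circleAverage (fun z => (a + b * z.re) ^ s) 0 1 := by
  simp [laplaceIntegral, circleAverage, circleMap, Complex.exp_ofReal_mul_I_re]

theorem rpow_eq_rpow_sub_one_mul {w s : ℝ} (hw : 0 < w ∨ 0 ≤ w ∧ s ≠ 0) :
    w ^ s = w ^ (s - 1) * w := by
  rcases hw with hw | ⟨hw, hs⟩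
  · rw [rpow_sub_one hw.ne', div_mul_cancel₀ _ hw.ne']
  · rw [← rpow_add_one' hw (by simpa using hs), sub_add_cancel]

theorem rpow_add_one_eq_rpow_sub_one_mul_sq {w s : ℝ} (hw : 0 < w ∨ 0 ≤ w ∧ 1 ≤ s) :
    w ^ (s + 1) = w ^ (s - 1) * w ^ 2 := by
  rw [rpow_eq_rpow_sub_one_mul (s := s + 1) (hw.imp_right fun h => ⟨h.1, by linarith [h.2]⟩),
    add_sub_cancel_right, rpow_eq_rpow_sub_one_mul (hw.imp_right fun h => ⟨h.1, by linarith [h.2]⟩)]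
  ring

theorem two_mul_rpow_le {w s : ℝ} (hw : 0 < w ∨ 0 ≤ w ∧ 1 ≤ s) :
    2 * w ^ s ≤ w ^ (s - 1) + w ^ (s + 1) := by
  have hnonneg : 0 ≤ w ^ (s - 1) := rpow_nonneg (hw.elim le_of_lt And.left) _
  rw [rpow_add_one_eq_rpow_sub_one_mul_sq hw,
    rpow_eq_rpow_sub_one_mul (hw.imp_right fun h => ⟨h.1, by linarith [h.2]⟩)]
  linarith [mul_nonneg hnonneg (sq_nonneg (w - 1))]

variable {a b s : ℝ}

theorem add_mul_pos_or_nonneg {r t : ℝ} (h : |b| < a ∨ |b| ≤ a ∧ r ≤ s) (ht : |t| ≤ 1) :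
    0 < a + b * t ∨ 0 ≤ a + b * t ∧ r ≤ s := by
  have hbt : |b * t| ≤ |b| := by
    rw [abs_mul]
    exact mul_le_of_le_one_right (abs_nonneg b) ht
  have hneg := neg_abs_le (b * t)
  exact h.imp (fun h => by linarith) fun h => ⟨by linarith [h.1], h.2⟩

theorem intervalIntegrable_rpow_add_mul_cos (h : |b| < a ∨ |b| ≤ a ∧ 0 ≤ s) (u v : ℝ) :
    IntervalIntegrable (fun θ => (a + b * cos θ) ^ s) volume u v :=
  (Continuous.rpow_const (by fun_prop) fun θ =>
    (add_mul_pos_or_nonneg h (abs_cos_le_one θ)).imp ne_of_gt And.right).intervalIntegrable u v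

theorem two_mul_laplaceIntegral_le (h : |b| < a ∨ |b| ≤ a ∧ 1 ≤ s) :
    2 * laplaceIntegral a b s ≤ laplaceIntegral a b (s - 1) + laplaceIntegral a b (s + 1) := by
  have integrable {p : ℝ} (hp : s - 1 ≤ p) :=
    intervalIntegrable_rpow_add_mul_cos (s := p) (h.imp_right fun h => ⟨h.1, by linarith [h.2]⟩)
      0 (2 * π)
  have h₀ := integrable le_rfl
  have h₁ := integrable (p := s) (by linarith)
  have h₂ := integrable (p := s + 1) (by linarith)
  simp only [laplaceIntegral]
  rw [← mul_add, mul_left_comm, ← intervalIntegral.integral_const_mul,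
    ← intervalIntegral.integral_add h₀ h₂]
  gcongr
  exact intervalIntegral.integral_mono_on two_pi_pos.le (h₁.const_mul 2) (h₀.add h₂) fun θ _ =>
    two_mul_rpow_le (add_mul_pos_or_nonneg h (abs_cos_le_one θ))

theorem hasDerivAt_sin_mul_rpow (h : |b| < a ∨ |b| ≤ a ∧ 1 ≤ s) (θ : ℝ) :
    HasDerivAt (fun t => b * (sin t * (a + b * cos t) ^ s))
      ((s + 1) * (a + b * cos θ) ^ (s + 1) - (2 * s + 1) * a * (a + b * cos θ) ^ s +
        s * (a ^ 2 - b ^ 2) * (a + b * cos θ) ^ (s - 1)) θ := by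
  have hw := add_mul_pos_or_nonneg h (abs_cos_le_one θ)
  have hpow := (((hasDerivAt_cos θ).const_mul b).const_add a).rpow_const (p := s)
    (hw.imp ne_of_gt And.right)
  refine (((hasDerivAt_sin θ).mul hpow).const_mul b).congr_deriv ?_
  rw [rpow_add_one_eq_rpow_sub_one_mul_sq hw,
    rpow_eq_rpow_sub_one_mul (hw.imp_right fun h => ⟨h.1, by linarith [h.2]⟩)]
  linear_combination -(s * b ^ 2 * (a + b * cos θ) ^ (s - 1)) * sin_sq_add_cos_sq θ

theorem laplaceIntegral_recurrence (h : |b| < a ∨ |b| ≤ a ∧ 1 ≤ s) :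
    (s + 1) * laplaceIntegral a b (s + 1) =
      (2 * s + 1) * a * laplaceIntegral a b s -
        s * (a ^ 2 - b ^ 2) * laplaceIntegral a b (s - 1) := by
  have integrable (c : ℝ) {p : ℝ} (hp : s - 1 ≤ p) :=
    (intervalIntegrable_rpow_add_mul_cos (s := p) (h.imp_right fun h => ⟨h.1, by linarith [h.2]⟩)
      0 (2 * π)).const_mul c
  have h₀ := integrable (s * (a ^ 2 - b ^ 2)) le_rfl
  have h₁ := integrable ((2 * s + 1) * a) (p := s) (by linarith)
  have h₂ := integrable (s + 1) (p := s + 1) (by linarith)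
  have hzero := intervalIntegral.integral_eq_sub_of_hasDerivAt
    (fun θ _ => hasDerivAt_sin_mul_rpow h θ) ((h₂.sub h₁).add h₀)
  rw [intervalIntegral.integral_add (h₂.sub h₁) h₀, intervalIntegral.integral_sub h₂ h₁] at hzero
  simp only [intervalIntegral.integral_const_mul, sin_two_pi, sin_zero, zero_mul, mul_zero,
    sub_zero] at hzero
  simp only [laplaceIntegral]
  linear_combination (2 * π)⁻¹ * hzero

end LaplaceIntegral

section CoincidenceIntegral

/-- The mean of `(‖1 + x z‖ ^ 2 / (1 + x) ^ 2) ^ s` over the unit circle, as a Laplace integral.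
All three indices of coincidence are values of this function. -/
noncomputable def coincidenceIntegral (x s : ℝ) : ℝ :=
  laplaceIntegral ((1 + x ^ 2) / (1 + x) ^ 2) (2 * x / (1 + x) ^ 2) s

theorem norm_one_add_mul_sq (x : ℝ) {z : ℂ} (hz : ‖z‖ = 1) :
    ‖1 + x * z‖ ^ 2 = 1 + x ^ 2 + 2 * x * z.re := by
  have hz' : z.re * z.re + z.im * z.im = 1 := by
    rw [← Complex.normSq_apply, Complex.normSq_eq_norm_sq, hz, one_pow]
  rw [← Complex.normSq_eq_norm_sq, Complex.normSq_apply]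
  simp only [Complex.add_re, Complex.add_im, Complex.one_re, Complex.one_im, Complex.re_ofReal_mul,
    Complex.im_ofReal_mul]
  linear_combination x ^ 2 * hz'

theorem coincidenceIntegral_eq_circleAverage (x s : ℝ) :
    coincidenceIntegral x s =
      circleAverage (fun z => ((‖1 + x * z‖ / (1 + x)) ^ 2) ^ s) 0 1 := by
  rw [coincidenceIntegral, laplaceIntegral_eq_circleAverage]
  refine circleAverage_congr_sphere fun z hz => ?_
  rw [div_pow, norm_one_add_mul_sq x (by simpa using hz), div_mul_eq_mul_div, ← add_div]

variable {x s : ℝ}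

theorem abs_two_mul_div_lt_or_le {r : ℝ} (hx : x ≠ -1) (h : x ≠ 1 ∨ r ≤ s) :
    |2 * x / (1 + x) ^ 2| < (1 + x ^ 2) / (1 + x) ^ 2 ∨
      |2 * x / (1 + x) ^ 2| ≤ (1 + x ^ 2) / (1 + x) ^ 2 ∧ r ≤ s := by
  have hpos : 0 < (1 + x) ^ 2 := sq_pos_of_ne_zero fun h => hx (by linarith)
  rw [abs_div, abs_of_pos hpos, div_lt_div_iff_of_pos_right hpos, div_le_div_iff_of_pos_right hpos,
    abs_lt, abs_le]
  refine h.imp (fun hx1 => ?_) fun h => ⟨?_, h⟩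
  · have := sq_pos_of_ne_zero (sub_ne_zero.2 hx1)
    constructor <;> linarith
  · constructor <;> linarith [sq_nonneg (x - 1)]

theorem two_mul_coincidenceIntegral_le (hx : x ≠ -1) (h : x ≠ 1 ∨ 1 ≤ s) :
    2 * coincidenceIntegral x s ≤ coincidenceIntegral x (s - 1) + coincidenceIntegral x (s + 1) :=
  two_mul_laplaceIntegral_le (abs_two_mul_div_lt_or_le hx h)

theorem coincidenceIntegral_recurrence (hx : x ≠ -1) (h : x ≠ 1 ∨ 1 ≤ s) :
    (s + 1) * (1 + x) ^ 2 * coincidenceIntegral x (s + 1) =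
      (2 * s + 1) * (1 + x ^ 2) * coincidenceIntegral x s -
        s * (1 - x) ^ 2 * coincidenceIntegral x (s - 1) := by
  have hx' : 1 + x ≠ 0 := fun h => hx (by linarith)
  have hrec := laplaceIntegral_recurrence (abs_two_mul_div_lt_or_le hx h)
  rw [← coincidenceIntegral, ← coincidenceIntegral, ← coincidenceIntegral] at hrec
  have hdisc : ((1 + x ^ 2) / (1 + x) ^ 2) ^ 2 - (2 * x / (1 + x) ^ 2) ^ 2 =
      (1 - x) ^ 2 / (1 + x) ^ 2 := by
    field_simp
    ring
  rw [hdisc] at hrec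
  field_simp at hrec
  linear_combination hrec

theorem ratio_le_of_convex_of_recurrence {m x A₀ A₁ A₂ : ℝ} (hm : -(1 / 2) ≤ m)
    (hD : 0 < 1 + (4 * m + 4) * x + x ^ 2) (hconv : 2 * A₁ ≤ A₀ + A₂)
    (hrec : (m + 1) * (1 + x) ^ 2 * A₂ =
      (2 * m + 1) * (1 + x ^ 2) * A₁ - m * (1 - x) ^ 2 * A₀) :
    A₂ ≤ (1 + 4 * m * x + x ^ 2) / (1 + (4 * m + 4) * x + x ^ 2) * A₀ ∧
      A₁ ≤ (1 + (4 * m + 2) * x + x ^ 2) / (1 + (4 * m + 4) * x + x ^ 2) * A₀ := by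
  have h₂ : A₂ * (1 + (4 * m + 4) * x + x ^ 2) ≤ (1 + 4 * m * x + x ^ 2) * A₀ := by
    have := mul_le_mul_of_nonneg_left hconv
      (mul_nonneg (by linarith : 0 ≤ 2 * m + 1) (by positivity : 0 ≤ 1 + x ^ 2))
    linarith
  have h₁ := mul_le_mul_of_nonneg_right hconv hD.le
  rw [div_mul_eq_mul_div, div_mul_eq_mul_div, le_div_iff₀ hD, le_div_iff₀ hD]
  exact ⟨h₂, by linarith⟩

end CoincidenceIntegral

section Indices

theorem hasSum_choose_mul_pow (n : ℕ) (x : ℝ) (z : ℂ) :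
    HasSum (fun k => ((n.choose k * x ^ k / (1 + x) ^ n : ℝ) : ℂ) * z ^ k)
      (((1 + x * z) / (1 + x)) ^ n) := by
  have hsum : ((1 + x * z) / (1 + x)) ^ n =
      ∑ k ∈ Finset.range (n + 1), ((n.choose k * x ^ k / (1 + x) ^ n : ℝ) : ℂ) * z ^ k := by
    rw [div_pow, add_comm (1 : ℂ) (x * z), add_pow, Finset.sum_div]
    refine Finset.sum_congr rfl fun k _ => ?_
    push_cast
    ring
  rw [hsum]
  refine hasSum_sum_of_ne_finset_zero fun k hk => ?_
  rw [Nat.choose_eq_zero_of_lt (by simpa using hk)]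
  simp

theorem indexU_eq_coincidenceIntegral (n : ℕ) (x : ℝ) :
    indexU n x = coincidenceIntegral x n := by
  have hsq := hasSum_norm_sq_circleAverage fun z _ => hasSum_choose_mul_pow n x z
  have hfin := hasSum_sum_of_ne_finset_zero (L := .unconditional ℕ) (s := Finset.range (n + 1))
    (f := fun k => (n.choose k * x ^ k / (1 + x) ^ n) ^ 2) fun k hk => by
      rw [Nat.choose_eq_zero_of_lt (by simpa using hk)]
      simp
  simp only [Complex.norm_real, norm_eq_abs, sq_abs] at hsq
  rw [indexU, hfin.unique hsq, coincidenceIntegral_eq_circleAverage]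
  have hnorm : ‖(1 + x : ℂ)‖ = |1 + x| := by
    exact_mod_cast Complex.norm_real (1 + x)
  congr! 2 with z
  rw [norm_pow, norm_div, hnorm, rpow_natCast, ← pow_mul, mul_comm n, pow_mul]
  simp only [div_pow, sq_abs]

theorem hasSum_choose_add_mul_pow (a : ℂ) {w : ℂ} (hw : ‖w‖ < 1) :
    HasSum (fun k : ℕ => Ring.choose (a + k) k * w ^ k) ((1 - w) ^ (a + 1))⁻¹ := by
  have h := (Complex.one_div_one_sub_cpow_hasFPowerSeriesOnBall_zero (a + 1)).hasSum (y := w)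
    (by simpa [← ofReal_norm] using hw)
  simpa only [FormalMultilinearSeries.ofScalars_apply_eq, smul_eq_mul, add_right_comm a,
    add_sub_cancel_right, zero_add, one_div] using h

theorem hasSum_weightJ_mul_pow (n : ℝ) {x : ℝ} (hx : |x| < 1) {z : ℂ} (hz : ‖z‖ = 1) :
    HasSum (fun k => (weightJ n x k : ℂ) * z ^ k)
      (((1 - x) ^ (n + 1) : ℝ) / (1 - x * z) ^ ((n + 1 : ℝ) : ℂ)) := by
  have h := (hasSum_choose_add_mul_pow n (w := x * z) (by simpa [hz] using hx)).mul_left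
    (((1 - x) ^ (n + 1) : ℝ) : ℂ)
  have hterm : (fun k => (weightJ n x k : ℂ) * z ^ k) = fun k : ℕ =>
      (((1 - x) ^ (n + 1) : ℝ) : ℂ) * (Ring.choose ((n : ℂ) + k) k * (x * z) ^ k) := by
    funext k
    rw [weightJ, mul_pow]
    push_cast [Complex.ofReal_choose]
    ring
  rw [hterm, div_eq_mul_inv, Complex.ofReal_add, Complex.ofReal_one]
  exact h

theorem hasSum_weightJ_sq (n : ℝ) {x : ℝ} (hx : |x| < 1) :
    HasSum (fun k => weightJ n x k ^ 2) (coincidenceIntegral (-x) (-(n + 1))) := by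
  have h1 : 0 ≤ 1 - x := by linarith [(abs_lt.1 hx).2]
  have hsq := hasSum_norm_sq_circleAverage fun z => hasSum_weightJ_mul_pow n hx (z := z)
  simp only [Complex.norm_real, norm_eq_abs, sq_abs] at hsq
  convert hsq using 1
  rw [coincidenceIntegral_eq_circleAverage]
  congr! 2 with z
  rw [norm_div, Complex.norm_cpow_real, Complex.norm_real, norm_of_nonneg (by positivity),
    ← div_rpow h1 (norm_nonneg _), rpow_pow_comm (by positivity), rpow_neg_eq_inv_rpow, ← inv_pow,
    inv_div, Complex.ofReal_neg, neg_mul, ← sub_eq_add_neg, ← sub_eq_add_neg]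

theorem weightG_eq_weightJ (n : ℝ) {x : ℝ} (hx : -1 < x) :
    weightG n x = weightJ (n - 1) (x / (1 + x)) := by
  have h1 : 0 < 1 + x := by linarith
  have hsub : 1 - x / (1 + x) = (1 + x)⁻¹ := by
    field_simp
    ring
  funext k
  rw [weightG, weightJ, hsub, inv_rpow h1.le, ← rpow_neg h1.le, sub_eq_add_neg (-n),
    rpow_add h1, rpow_neg h1.le (k : ℝ), rpow_natCast, div_pow, sub_add_cancel,
    sub_add_eq_add_sub]
  ring

theorem indexG_eq_indexJ (n : ℝ) {x : ℝ} (hx : -1 < x) :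
    indexG n x = indexJ (n - 1) (x / (1 + x)) := by
  rw [indexG, indexJ, weightG_eq_weightJ n hx]

theorem abs_div_one_add_lt_one {x : ℝ} (hx : -(1 / 2) < x) : |x / (1 + x)| < 1 := by
  have h1 : 0 < 1 + x := by linarith
  rw [abs_lt, lt_div_iff₀ h1, div_lt_one h1]
  constructor <;> linarith

theorem summable_weightG_sq (n : ℝ) {x : ℝ} (hx : -(1 / 2) < x) :
    Summable fun k => weightG n x k ^ 2 := by
  rw [weightG_eq_weightJ n (by linarith)]
  exact (hasSum_weightJ_sq (n - 1) (abs_div_one_add_lt_one hx)).summable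

theorem two_mul_indexU_le {n : ℕ} (hn : 1 ≤ n) {x : ℝ} (hx : x ≠ -1) :
    2 * indexU n x ≤ indexU (n - 1) x + indexU (n + 1) x := by
  have hn' : (1 : ℝ) ≤ n := by exact_mod_cast hn
  simpa only [indexU_eq_coincidenceIntegral, Nat.cast_pred hn, Nat.cast_succ] using
    two_mul_coincidenceIntegral_le hx (.inr hn')

theorem indexU_ratio_le {n : ℕ} (hn : 1 ≤ n) {x : ℝ} (hx : x ≠ -1)
    (hD : 0 < 1 + (4 * (n : ℝ) + 4) * x + x ^ 2) :
    indexU (n + 1) x ≤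
        (1 + 4 * (n : ℝ) * x + x ^ 2) / (1 + (4 * (n : ℝ) + 4) * x + x ^ 2) * indexU (n - 1) x ∧
      indexU n x ≤
        (1 + (4 * (n : ℝ) + 2) * x + x ^ 2) / (1 + (4 * (n : ℝ) + 4) * x + x ^ 2) *
          indexU (n - 1) x := by
  have hn' : (1 : ℝ) ≤ n := by exact_mod_cast hn
  refine ratio_le_of_convex_of_recurrence (by linarith) hD (two_mul_indexU_le hn hx) ?_
  simpa only [indexU_eq_coincidenceIntegral, Nat.cast_pred hn, Nat.cast_succ] using
    coincidenceIntegral_recurrence hx (.inr hn')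

theorem indexJ_eq_coincidenceIntegral (n : ℝ) {x : ℝ} (hx : |x| < 1) :
    indexJ n x = coincidenceIntegral (-x) (-(n + 1)) :=
  (hasSum_weightJ_sq n hx).tsum_eq

theorem two_mul_indexJ_le (n : ℝ) {x : ℝ} (hx : |x| < 1) :
    2 * indexJ n x ≤ indexJ (n - 1) x + indexJ (n + 1) x := by
  obtain ⟨hx₁, hx₂⟩ := abs_lt.1 hx
  have h := two_mul_coincidenceIntegral_le (x := -x) (s := -(n + 1)) (by grind) (.inl (by grind))
  simp only [indexJ_eq_coincidenceIntegral _ hx]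
  ring_nf at h ⊢
  linarith

theorem indexJ_recurrence (n : ℝ) {x : ℝ} (hx : |x| < 1) :
    (n + 1) * (1 + x) ^ 2 * indexJ (n + 1) x =
      (2 * n + 1) * (1 + x ^ 2) * indexJ n x - n * (1 - x) ^ 2 * indexJ (n - 1) x := by
  obtain ⟨hx₁, hx₂⟩ := abs_lt.1 hx
  have h := coincidenceIntegral_recurrence (x := -x) (s := -(n + 1)) (by grind) (.inl (by grind))
  simp only [indexJ_eq_coincidenceIntegral _ hx]
  ring_nf at h ⊢
  linarith

theorem indexJ_ratio_le {n x : ℝ} (hn : -(1 / 2) ≤ n) (hx : |x| < 1)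
    (hD : 0 < 1 + (4 * n + 4) * x + x ^ 2) :
    indexJ (n + 1) x ≤
        (1 + 4 * n * x + x ^ 2) / (1 + (4 * n + 4) * x + x ^ 2) * indexJ (n - 1) x ∧
      indexJ n x ≤
        (1 + (4 * n + 2) * x + x ^ 2) / (1 + (4 * n + 4) * x + x ^ 2) * indexJ (n - 1) x :=
  ratio_le_of_convex_of_recurrence hn hD (two_mul_indexJ_le n hx) (indexJ_recurrence n hx)

theorem two_mul_indexG_le (n : ℝ) {x : ℝ} (hx : -(1 / 2) < x) :
    2 * indexG n x ≤ indexG (n - 1) x + indexG (n + 1) x := by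
  simp only [indexG_eq_indexJ _ (by linarith : -1 < x)]
  rw [add_sub_right_comm]
  exact two_mul_indexJ_le (n - 1) (abs_div_one_add_lt_one hx)

theorem indexG_ratio_le {n x : ℝ} (hn : 1 / 2 ≤ n) (hx : -(1 / 2) < x)
    (hD : 0 < 1 + (4 * n + 2) * x * (1 + x)) :
    indexG (n + 1) x ≤
        (1 + (4 * n - 2) * x * (1 + x)) / (1 + (4 * n + 2) * x * (1 + x)) * indexG (n - 1) x ∧
      indexG n x ≤
        (1 + 4 * n * x * (x + 1)) / (1 + (4 * n + 2) * x * (x + 1)) * indexG (n - 1) x := by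
  have h1 : 0 < 1 + x := by linarith
  have hscale (p : ℝ) : 1 + p * (x / (1 + x)) + (x / (1 + x)) ^ 2 =
      (1 + (p + 2) * x * (1 + x)) / (1 + x) ^ 2 := by
    field_simp
    ring
  have hD' : 0 < 1 + (4 * (n - 1) + 4) * (x / (1 + x)) + (x / (1 + x)) ^ 2 := by
    rw [hscale, show 4 * (n - 1) + 4 + 2 = 4 * n + 2 by ring]
    positivity
  have h := indexJ_ratio_le (by linarith) (abs_div_one_add_lt_one hx) hD'
  simp only [hscale, div_div_div_cancel_right₀ (pow_ne_zero 2 h1.ne')] at h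
  simp only [indexG_eq_indexJ _ (by linarith : -1 < x), add_comm x 1]
  convert h using 5 <;> ring

end Indices

theorem theorem3p2_general :
    (∀ (n : ℕ) (x : ℝ), 1 ≤ n → x ≠ -1 →
      2 * indexU n x ≤ indexU (n - 1) x + indexU (n + 1) x ∧
      (0 < 1 + (4 * (n : ℝ) + 4) * x + x ^ 2 →
        indexU (n + 1) x ≤
            (1 + 4 * (n : ℝ) * x + x ^ 2) / (1 + (4 * (n : ℝ) + 4) * x + x ^ 2) *
              indexU (n - 1) x ∧
          indexU n x ≤
            (1 + (4 * (n : ℝ) + 2) * x + x ^ 2) / (1 + (4 * (n : ℝ) + 4) * x + x ^ 2) *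
              indexU (n - 1) x)) ∧
    (∀ n x : ℝ, -(1 / 2) < x →
      Summable (fun k : ℕ => (weightG n x k) ^ 2) ∧
      2 * indexG n x ≤ indexG (n - 1) x + indexG (n + 1) x ∧
      (1 / 2 ≤ n → 0 < 1 + (4 * n + 2) * x * (1 + x) →
        indexG (n + 1) x ≤
            (1 + (4 * n - 2) * x * (1 + x)) / (1 + (4 * n + 2) * x * (1 + x)) *
              indexG (n - 1) x ∧
          indexG n x ≤
            (1 + 4 * n * x * (x + 1)) / (1 + (4 * n + 2) * x * (x + 1)) *
              indexG (n - 1) x)) ∧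
    (∀ n x : ℝ, |x| < 1 →
      Summable (fun k : ℕ => (weightJ n x k) ^ 2) ∧
      2 * indexJ n x ≤ indexJ (n - 1) x + indexJ (n + 1) x ∧
      (-(1 / 2) ≤ n → 0 < 1 + (4 * n + 4) * x + x ^ 2 →
        indexJ (n + 1) x ≤
            (1 + 4 * n * x + x ^ 2) / (1 + (4 * n + 4) * x + x ^ 2) * indexJ (n - 1) x ∧
          indexJ n x ≤
            (1 + (4 * n + 2) * x + x ^ 2) / (1 + (4 * n + 4) * x + x ^ 2) *
              indexJ (n - 1) x)) :=
  ⟨fun _ _ hn hx => ⟨two_mul_indexU_le hn hx, indexU_ratio_le hn hx⟩,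
    fun n _ hx => ⟨summable_weightG_sq n hx, two_mul_indexG_le n hx,
      fun hn hD => indexG_ratio_le hn hx hD⟩,
    fun n _ hx => ⟨(hasSum_weightJ_sq n hx).summable, two_mul_indexJ_le n hx,
      fun hn hD => indexJ_ratio_le hn hx hD⟩⟩

theorem theorem3p2 :
    (∀ (n : ℕ) (x : ℝ), 1 ≤ n → 0 ≤ x →
      2 * indexU n x ≤ indexU (n - 1) x + indexU (n + 1) x ∧
      indexU (n + 1) x ≤
        (1 + 4 * (n : ℝ) * x + x ^ 2) / (1 + (4 * (n : ℝ) + 4) * x + x ^ 2) *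
          indexU (n - 1) x ∧
      indexU n x ≤
        (1 + (4 * (n : ℝ) + 2) * x + x ^ 2) / (1 + (4 * (n : ℝ) + 4) * x + x ^ 2) *
          indexU (n - 1) x) ∧
    (∀ n x : ℝ, 0 ≤ n → 0 ≤ x → Summable (fun k : ℕ => (weightG n x k) ^ 2)) ∧
    (∀ n x : ℝ, 1 ≤ n → 0 ≤ x →
      2 * indexG n x ≤ indexG (n - 1) x + indexG (n + 1) x ∧
      indexG (n + 1) x ≤
        (1 + (4 * n - 2) * x * (1 + x)) / (1 + (4 * n + 2) * x * (1 + x)) *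
          indexG (n - 1) x ∧
      indexG n x ≤
        (1 + 4 * n * x * (x + 1)) / (1 + (4 * n + 2) * x * (x + 1)) *
          indexG (n - 1) x) ∧
    (∀ n x : ℝ, 0 ≤ n → 0 ≤ x → x < 1 → Summable (fun k : ℕ => (weightJ n x k) ^ 2)) ∧
    (∀ n x : ℝ, 1 ≤ n → 0 ≤ x → x < 1 →
      2 * indexJ n x ≤ indexJ (n - 1) x + indexJ (n + 1) x ∧
      indexJ (n + 1) x ≤
        (1 + 4 * n * x + x ^ 2) / (1 + (4 * n + 4) * x + x ^ 2) * indexJ (n - 1) x ∧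
      indexJ n x ≤
        (1 + (4 * n + 2) * x + x ^ 2) / (1 + (4 * n + 4) * x + x ^ 2) *
          indexJ (n - 1) x) := by
  obtain ⟨hU, hG, hJ⟩ := theorem3p2_general
  have habs {x : ℝ} (hx₀ : 0 ≤ x) (hx₁ : x < 1) : |x| < 1 := by rwa [abs_of_nonneg hx₀]
  exact ⟨fun n x hn hx => (hU n x hn (by linarith)).imp_right fun h => h (by positivity),
    fun n x _ hx => (hG n x (by linarith)).1,
    fun n x hn hx => (hG n x (by linarith)).2.imp_right fun h => h (by linarith) (by positivity),
    fun n x _ hx₀ hx₁ => (hJ n x (habs hx₀ hx₁)).1,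
    fun n x hn hx₀ hx₁ =>
      (hJ n x (habs hx₀ hx₁)).2.imp_right fun h => h (by linarith) (by positivity)⟩
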